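/- Let $\mathbf{1Met}$ be the category of 1-bounded metric spaces (sets $X$ with a metric $d:X\times X\to[0,1]$) and non-expansive maps. Write $X+\mathbf 1=X\cup\{\star\}$, with the metric extending $d$ by $d(x,\star)=1$ for $x\in X$, and let $\mathcal D(Y)$ be the set of finitely supported probability distributions on $Y$. For a set $X$ let $\mathcal C^{\downarrow}(X)$ be the set of all non-empty convex sets $S\subseteq\mathcal D(X+\mathbf 1)$ that are the convex hull of a finite set and are $\bot$-closed, i.e. if $\varphi\in S$, $\psi\in\mathcal D(X+\mathbf 1)$ and $\psi(x)\le\varphi(x)$ for all $x\in X$, then $\psi\in S$. For $(X,d)\in\mathbf{1Met}$ let $K(d)$ be the Kantorovich distance on $\mathcal D(X+\mathbf 1)$, $$K(d)(\varphi,\psi)=\inf_{\omega}\sum_{(y,z)}\omega(y,z)\,d(y,z),$$ the infimum being over all couplings $\omega\in\mathcal D((X+\mathbf 1)\times(X+\mathbf 1))$ of $\varphi$ and $\psi$, and let $HK(d)$ be the Hausdorff distance on $\mathcal C^{\downarrow}(X)$ induced by $K(d)$, $$HK(d)(S,T)=\max\Big\{\sup_{\varphi\in S}\inf_{\psi\in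 T}K(d)(\varphi,\psi),\ \sup_{\psi\in T}\inf_{\varphi\in S}K(d)(\varphi,\psi)\Big\}.$$ **Theorem.** The Hausdorff–Kantorovich lifting of the $\mathbf{Set}$ monad $\mathcal C^{\downarrow}$ is a monad on $\mathbf{1Met}$. That is, $HK(d)$ is a 1-bounded metric on $\mathcal C^{\downarrow}(X)$ for every $(X,d)\in\mathbf{1Met}$, and there is a monad on $\mathbf{1Met}$ with object map $(X,d)\mapsto(\mathcal C^{\downarrow}(X),HK(d))$ whose action on morphisms, unit and multiplication are, as functions, those of the $\mathbf{Set}$ monad $\mathcal C^{\downarrow}$ (in particular these functions are well defined and non-expansive): 1. a non-expansive $f:X\to Y$ is sent to $S\mapsto\{\mathcal D(f+\mathbf 1)(\varphi)\mid\varphi\in S\}$, where $f+\mathbf 1$ extends $f$ by $\star\mapsto\star$ and $\mathcal D(f+\mathbf 1)$ is the push-forward of distributions; 2. the unit is $\eta_X(x)=\{p\,x+(1-p)\,\star\mid p\in[0,1]\}$; 3. the multiplication is $\mu_X(S)=\bigcup_{\Phi\in S}\mathtt{WMS}(\Phi^{\star})$ for $S\in\mathcal C^{\downarrow}(\mathcal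 C^{\downarrow}(X))$. Here $\Phi^{\star}$ is the push-forward of $\Phi\in\mathcal D(\mathcal C^{\downarrow}(X)+\mathbf 1)$ along the map that fixes $\mathcal C^{\downarrow}(X)$ and sends the extra point to $\{\delta_\star\}$, and for a distribution $\sum_{i=1}^n p_iU_i$ with distinct $U_i$ and $p_i>0$, $\mathtt{WMS}(\sum_i p_iU_i)=\{\sum_i p_i\varphi_i\mid\varphi_i\in U_i\}$. -/

import Mathlib

open CategoryTheory Convexity

universe u

noncomputable section

/-! ### The category of 1-bounded metric spaces and non-expansive maps -/

/-- A real-valued function `d` on `A × A` is a 1-bounded metric. -/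
structure IsOneBoundedMetric {A : Type u} (d : A → A → ℝ) : Prop where
  nonneg : ∀ a b, 0 ≤ d a b
  le_one : ∀ a b, d a b ≤ 1
  eq_zero_iff : ∀ a b, d a b = 0 ↔ a = b
  symm : ∀ a b, d a b = d b a
  triangle : ∀ a b c, d a b ≤ d a c + d c b

/-- A 1-bounded metric space. -/
structure OneMet : Type (u + 1) where
  carrier : Type u
  [metric : MetricSpace carrier]
  dist_le_one : ∀ x y : carrier, dist x y ≤ 1

attribute [instance] OneMet.metric

namespace OneMet

/-- The 1-bounded metric space given by a set and a 1-bounded metric on it. -/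
def ofDist (A : Type u) (d : A → A → ℝ) (h : IsOneBoundedMetric d) : OneMet.{u} :=
  letI : MetricSpace A :=
    { dist := d
      dist_self := fun a => (h.eq_zero_iff a a).2 rfl
      dist_comm := h.symm
      dist_triangle := fun a b c => h.triangle a c b
      eq_of_dist_eq_zero := fun {a b} hab => (h.eq_zero_iff a b).1 hab }
  { carrier := A
    dist_le_one := h.le_one }

/-- A non-expansive map between 1-bounded metric spaces. -/
@[ext]
structure Hom (X Y : OneMet.{u}) : Type u where
  toFun : X.carrier → Y.carrier
  nonexpansive : ∀ x y, dist (toFun x) (toFun y) ≤ dist x y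

instance : Category OneMet.{u} where
  Hom := Hom
  id _ := ⟨fun x => x, fun _ _ => le_rfl⟩
  comp f g := ⟨fun x => g.toFun (f.toFun x),
    fun x y => (g.nonexpansive _ _).trans (f.nonexpansive x y)⟩

end OneMet

/-! ### Finitely supported distributions and the Kantorovich and Hausdorff liftings -/

/-- `Distr A` is the set of finitely supported probability distributions on `A`.
A subdistribution on `A` is an element of `Distr (Option A)`,
where `none` is the extra point `⋆` of `A + 1`. -/
abbrev Distr (A : Type u) : Type u := StdSimplex ℝ A

/-- The metric of the coproduct of `A` with the one-point space: the distance from a point of `A`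
to the extra point is `1`. -/
def optionDist {A : Type u} (d : A → A → ℝ) : Option A → Option A → ℝ
  | some a, some b => d a b
  | none, none => 0
  | some _, none => 1
  | none, some _ => 1

/-- The couplings of two distributions. -/
def Coup {A : Type u} (φ ψ : Distr A) : Set (Distr (A × A)) :=
  {ω | ω.map Prod.fst = φ ∧ ω.map Prod.snd = ψ}

/-- The Kantorovich lifting of `d`: the infimum of the transport costs over all couplings. -/
def kantorovich {A : Type u} (d : A → A → ℝ) (φ ψ : Distr A) : ℝ :=
  ⨅ ω : Coup φ ψ, ω.1.weights.sum fun p r => r * d p.1 p.2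

/-- The Hausdorff lifting of `d`. It is used on non-empty sets and for bounded `d` only. -/
def hausdorff {A : Type u} (d : A → A → ℝ) (S T : Set A) : ℝ :=
  max (⨆ s : S, ⨅ t : T, d s t) (⨆ t : T, ⨅ s : S, d s t)

/-! ### The set functor of finitely generated `⊥`-closed convex sets of subdistributions -/

/-- Non-empty, finitely generated convex sets of distributions. -/
structure IsFGConvex {A : Type u} (S : Set (Distr A)) : Prop where
  nonempty : S.Nonempty
  convex : IsConvexSet ℝ S
  finGen : ∃ B : Set (Distr A), B.Finite ∧ S = Convexity.convexHull ℝ B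

/-- A set of subdistributions is `⊥`-closed if it contains with `φ` every subdistribution that is
pointwise below `φ` on `A`. -/
def IsBotClosed {A : Type u} (S : Set (Distr (Option A))) : Prop :=
  ∀ φ ∈ S, ∀ ψ : Distr (Option A),
    (∀ a : A, ψ.weights (some a) ≤ φ.weights (some a)) → ψ ∈ S

/-- `Cdown A` is the set of non-empty finitely generated `⊥`-closed convex sets of subdistributions
on `A`. -/
def Cdown (A : Type u) : Type u :=
  {S : Set (Distr (Option A)) // IsFGConvex S ∧ IsBotClosed S}

/-- The set of subdistributions underlying an element of `Cdown A`. -/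
def Cdown.toSet {A : Type u} (S : Cdown A) : Set (Distr (Option A)) := S.1

/-- The action of the functor on a map: the set of the push-forwards along `f + 1`. -/
def cdownMap {A B : Type u} (f : A → B) (S : Set (Distr (Option A))) : Set (Distr (Option B)) :=
  (fun φ => φ.map (Option.map f)) '' S

/-- The unit: the set of the distributions `p x + (1 - p) ⋆` with `p` in `[0, 1]`. -/
def cdownUnit {A : Type u} (x : A) : Set (Distr (Option A)) :=
  {φ | ∃ (p : ℝ) (h₀ : 0 ≤ p) (h₁ : p ≤ 1),
    φ = StdSimplex.duple (some x) none h₀ (sub_nonneg.2 h₁) (add_sub_cancel p 1)}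

/-- The weighted Minkowski sum of a distribution on sets of distributions: all the sums
`∑ U, Ψ U • g U` with `g U ∈ U` for every `U` in the support of `Ψ`. -/
def wms {A : Type u} (Ψ : Distr (Set (Distr A))) : Set (Distr A) :=
  {θ | ∃ g : Set (Distr A) → Distr A,
    (∀ U ∈ Ψ.weights.support, g U ∈ U) ∧ θ = StdSimplex.iConvexComb Ψ g}

/-- The map `C↓(A) + 1 → C(A + 1)` that is the inclusion on `C↓(A)` and sends the extra point to
`{δ_⋆}`. -/
def cdownStar {A : Type u} : Option (Cdown A) → Set (Distr (Option A))
  | some U => U.toSet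
  | none => {StdSimplex.single none}

/-- The multiplication: the union of the weighted Minkowski sums of the distributions `Φ^⋆`,
for `Φ ∈ S`, where `Φ^⋆` is the push-forward of `Φ` along `cdownStar`. -/
def cdownMul {A : Type u} (S : Set (Distr (Option (Cdown A)))) : Set (Distr (Option A)) :=
  ⋃ Φ ∈ S, wms (Φ.map cdownStar)

/-! ### The lifting to 1-bounded metric spaces -/

/-- The Hausdorff–Kantorovich distance on `C↓(X)` for a 1-bounded metric space `X`. -/
def hausKant (X : OneMet.{u}) (S T : Cdown X.carrier) : ℝ :=
  hausdorff (kantorovich (optionDist (fun x y : X.carrier => dist x y))) S.toSet T.toSet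

/-- The object `(C↓(X), HK(d))`, given that the Hausdorff–Kantorovich distance is a 1-bounded
metric on `C↓(X)` for every `X`. -/
def hkObj (h : ∀ X : OneMet.{u}, IsOneBoundedMetric (hausKant X)) (X : OneMet.{u}) : OneMet.{u} :=
  OneMet.ofDist (Cdown X.carrier) (hausKant X) (h X)

end

/-!
The multiplication of `C↓` is the Kleisli extension `S ↦ ⋃ Φ ∈ S, ∑ o, Φ o • G o` of the
finitely generated convex sets monad, evaluated at `G = cdownStar`. That `Φ` may be pushed forward
along a map which is not injective costs convexity of the `G o` only: the points chosen over one
fibre are replaced by their barycentre. A set `S` is `⊥`-closed exactly if its extension along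
`o ↦ {ψ | ψ ≤ δ_o}` is contained in `S`, so associativity of the extension handles both
`⊥`-closedness and the monad laws.

`HK(d)` separates points because finitely generated convex sets are closed for `K(d)`: their members
are supported in one finite set, where `K(d)`-convergence forces convergence of the weights, and
the convex hull of finitely many points is compact.

The multiplication is non-expansive because a coupling `ω` of `Φ` and `Ψ` transports a selection
`g` for `Φ` to one for `Ψ`: choose for each pair `(o, o')` a member `k (o, o')` of `cdownStar o'`
that is nearly optimal for `g o`, and use that `K(d)` is jointly convex.
-/

section ConvexCombination

variable {R I J M N : Type*} [PartialOrder R] [Semiring R] [IsStrictOrderedRing R]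

lemma weights_iConvexComb_apply (w : StdSimplex R I) (f : I → StdSimplex R J) (j : J) :
    (w.iConvexComb f).weights j = w.iConvexComb fun i => (f i).weights j :=
  ((Finsupp.isAffineMap_eval (R := R) (X := R) (i := j)).comp
    (StdSimplex.isAffineMap_weights R J)).map_iConvexComb w f

lemma iConvexComb_single_eq_self (w : StdSimplex R I) :
    w.iConvexComb StdSimplex.single = w := by
  classical
  ext j
  simp [Finsupp.single_apply, Finsupp.sum, eq_comm]

lemma iConvexComb_piSingle [DecidableEq I] (w : StdSimplex R I) (i : I) (r : R) :
    w.iConvexComb (Pi.single i r) = w.weights i * r := by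
  simp +contextual [Pi.single_apply, iConvexComb_eq_sum, Finsupp.sum]

lemma iConvexComb_mono {w : StdSimplex R I} {f g : I → R}
    (h : ∀ i, w.weights i ≠ 0 → f i ≤ g i) : w.iConvexComb f ≤ w.iConvexComb g := by
  simp only [iConvexComb_eq_sum, smul_eq_mul]
  exact Finsupp.sum_le_sum fun i hi =>
    mul_le_mul_of_nonneg_left (h i (Finsupp.mem_support_iff.1 hi)) (w.weights_nonneg i)

lemma weights_le_one (w : StdSimplex R I) (i : I) : w.weights i ≤ 1 := by
  classical
  calc w.weights i = w.iConvexComb (Pi.single i 1) := by rw [iConvexComb_piSingle, mul_one]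
    _ ≤ w.iConvexComb fun _ => 1 := iConvexComb_mono fun j _ => by
      rw [Pi.single_apply]; split_ifs <;> simp
    _ = 1 := iConvexComb_const w 1

lemma iConvexComb_add [AddCommMonoid M] [Module R M] [ConvexSpace R M] [IsModuleConvexSpace R M]
    (w : StdSimplex R I) (f g : I → M) :
    (w.iConvexComb fun i => f i + g i) = w.iConvexComb f + w.iConvexComb g := by
  simp only [iConvexComb_eq_sum, smul_add, Finsupp.sum_add]

lemma isAffineMap_iConvexComb_left [ConvexSpace R M] (f : I → M) :
    IsAffineMap R fun w : StdSimplex R I => w.iConvexComb f where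
  map_sConvexComb W := by rw [← iConvexComb_id', ← iConvexComb_assoc]; rfl

lemma isAffineMap_pi {N : J → Type*} [ConvexSpace R M] [∀ j, ConvexSpace R (N j)]
    {f : M → ∀ j, N j} (hf : ∀ j, IsAffineMap R fun x => f x j) : IsAffineMap R f where
  map_sConvexComb w := funext fun j => by
    rw [Pi.sConvexComb_apply, iConvexComb_map, (hf j).map_sConvexComb]; rfl

lemma exists_forall_weights_ne_zero_imp (w : StdSimplex R I) {p : I → M → Prop}
    (h : ∀ i, w.weights i ≠ 0 → ∃ x, p i x) : ∃ g : I → M, ∀ i, w.weights i ≠ 0 → p i (g i) := by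
  obtain ⟨i, hi⟩ := w.support_weights_nonempty
  have : Nonempty M := (h i (Finsupp.mem_support_iff.1 hi)).nonempty
  choose! g hg using h
  exact ⟨g, hg⟩

lemma mapsTo_convexHull [ConvexSpace R M] [ConvexSpace R N] {f : M → N} (hf : IsAffineMap R f)
    {s : Set M} {t : Set N} (h : Set.MapsTo f s (Convexity.convexHull R t)) :
    Set.MapsTo f (Convexity.convexHull R s) (Convexity.convexHull R t) :=
  convexHull_min h (IsConvexSet.convexHull.preimage hf)

end ConvexCombination

lemma isAffineMap_iConvexComb_right {R I M : Type*} [PartialOrder R] [CommSemiring R]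
    [IsStrictOrderedRing R] [ConvexSpace R M] (w : StdSimplex R I) :
    IsAffineMap R fun f : I → M => w.iConvexComb f where
  map_sConvexComb F := by
    simp only [Pi.sConvexComb_apply]
    rw [iConvexComb_comm]; rfl

section CompProd

variable {R I J M : Type*} [PartialOrder R] [Semiring R] [IsStrictOrderedRing R]

/-- The joint distribution of a pair whose first component is distributed according to `w` and
whose second component is distributed according to `Φ i`, given that the first one is `i`. -/
noncomputable def compProd (w : StdSimplex R I) (Φ : I → StdSimplex R J) : StdSimplex R (I × J) :=
  w.iConvexComb fun i => (Φ i).map (Prod.mk i)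

lemma map_fst_compProd (w : StdSimplex R I) (Φ : I → StdSimplex R J) :
    (compProd w Φ).map Prod.fst = w := by
  simp only [compProd, map_iConvexComb, Function.comp_def, StdSimplex.map_map,
    StdSimplex.map_const, iConvexComb_single_eq_self]

lemma map_snd_compProd (w : StdSimplex R I) (Φ : I → StdSimplex R J) :
    (compProd w Φ).map Prod.snd = w.iConvexComb Φ := by
  have map_id (i : I) : (Φ i).map (fun j => j) = Φ i := (Φ i).map_id
  simp only [compProd, map_iConvexComb, Function.comp_def, StdSimplex.map_map, map_id]

lemma weights_compProd (w : StdSimplex R I) (Φ : I → StdSimplex R J) (p : I × J) :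
    (compProd w Φ).weights p = w.weights p.1 * (Φ p.1).weights p.2 := by
  classical
  have weights_map_mk (i : I) :
      ((Φ i).map (Prod.mk i)).weights p = if i = p.1 then (Φ p.1).weights p.2 else 0 := by
    split_ifs with hi
    · subst hi
      exact Finsupp.mapDomain_apply (Prod.mk_right_injective p.1) _ p.2
    · exact Finsupp.mapDomain_of_notMem_range _ _ (by rintro ⟨j, rfl⟩; exact hi rfl)
  simp only [compProd, weights_iConvexComb_apply, weights_map_mk, iConvexComb_eq_sum]
  simp +contextual [Finsupp.sum]

lemma iConvexComb_compProd [ConvexSpace R M] (w : StdSimplex R I) (Φ : I → StdSimplex R J)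
    (h : I × J → M) :
    (compProd w Φ).iConvexComb h = w.iConvexComb fun i => (Φ i).iConvexComb fun j => h (i, j) := by
  rw [iConvexComb_assoc']; rfl

end CompProd

section Fibre

variable {K I J : Type*} [Semifield K] [LinearOrder K] [IsStrictOrderedRing K]
  {w : StdSimplex K I} {f : I → J}

/-- The conditional distribution of `w` on the fibre of `f` over `j`. If that fibre has weight
zero, the value is `w` itself. -/
noncomputable def fibre (w : StdSimplex K I) (f : I → J) (j : J) : StdSimplex K I :=
  open Classical in
  if h : ∃ i ∈ f ⁻¹' {j}, w.weights i ≠ 0 then w.restrict (f ⁻¹' {j}) h else w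

lemma weights_map_eq_sum_filter [DecidableEq J] (w : StdSimplex K I) (f : I → J) (j : J) :
    (w.map f).weights j = (w.weights.filter (f · = j)).sum fun _ k => k := by
  simp +contextual [Finsupp.mapDomain, Finsupp.single_apply, Finsupp.sum, Finset.sum_filter,
    Finsupp.filter_apply]

lemma weights_map_ne_zero_iff {j : J} :
    (w.map f).weights j ≠ 0 ↔ ∃ i, f i = j ∧ w.weights i ≠ 0 := by
  classical
  rw [weights_map_eq_sum_filter, Finsupp.sum, ne_eq, Finset.sum_eq_zero_iff_of_nonneg
    fun i _ => by simp [Finsupp.filter_apply, apply_ite]]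
  simp only [Finsupp.mem_support_iff, Finsupp.filter_apply]
  grind

lemma weights_fibre_ne_zero_iff {j : J} (hj : (w.map f).weights j ≠ 0) {i : I} :
    (fibre w f j).weights i ≠ 0 ↔ f i = j ∧ w.weights i ≠ 0 := by
  classical
  have h : ∃ i ∈ f ⁻¹' {j}, w.weights i ≠ 0 := weights_map_ne_zero_iff.1 hj
  rw [fibre, dif_pos h, ← Finsupp.mem_support_iff, StdSimplex.support_weights_restrict]
  simp [and_comm]

lemma weights_map_mul_weights_fibre [DecidableEq J] (j : J) (i : I) :
    (w.map f).weights j * (fibre w f j).weights i = if f i = j then w.weights i else 0 := by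
  by_cases hj : (w.map f).weights j = 0
  · have h (hi : f i = j) : w.weights i = 0 := by
      by_contra hw
      exact weights_map_ne_zero_iff.2 ⟨i, hi, hw⟩ hj
    simp_all
  · have h : ∃ i ∈ f ⁻¹' {j}, w.weights i ≠ 0 := weights_map_ne_zero_iff.1 hj
    have : DecidablePred (· ∈ f ⁻¹' {j}) := fun i => inferInstanceAs (Decidable (f i = j))
    rw [weights_map_eq_sum_filter] at hj ⊢
    rw [fibre, dif_pos h, StdSimplex.weights_restrict]
    simp only [Set.mem_preimage, Set.mem_singleton_iff, Finsupp.smul_apply, smul_eq_mul,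
      mul_inv_cancel_left₀ hj, Finsupp.filter_apply]

lemma iConvexComb_fibre (w : StdSimplex K I) (f : I → J) :
    (w.map f).iConvexComb (fibre w f) = w := by
  classical
  ext i
  simp only [weights_iConvexComb_apply, iConvexComb_eq_sum, smul_eq_mul, Finsupp.sum,
    weights_map_mul_weights_fibre, Finset.sum_ite_eq, Finsupp.mem_support_iff,
    weights_map_ne_zero_iff]
  by_cases hi : w.weights i = 0
  · simp [hi]
  · rw [if_pos ⟨i, rfl, hi⟩]

lemma exists_coupling_of_map_eq {L : Type*} {v : StdSimplex K L} {g : L → J}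
    (h : w.map f = v.map g) :
    ∃ τ : StdSimplex K (I × L), τ.map Prod.fst = w ∧ τ.map Prod.snd = v ∧
      ∀ p, τ.weights p ≠ 0 → f p.1 = g p.2 := by
  refine ⟨compProd w fun i => fibre v g (f i), map_fst_compProd _ _, ?_, fun p hp => ?_⟩
  · rw [map_snd_compProd, ← iConvexComb_map, h, iConvexComb_fibre]
  · rw [weights_compProd, mul_ne_zero_iff] at hp
    have hfp : (v.map g).weights (f p.1) ≠ 0 :=
      h ▸ weights_map_ne_zero_iff.2 ⟨p.1, rfl, hp.1⟩
    exact ((weights_fibre_ne_zero_iff hfp).1 hp.2).1.symm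

end Fibre

section ConvexHullPi

variable {R I : Type*} [PartialOrder R] [Semiring R] [IsStrictOrderedRing R] {M : I → Type*}
  [∀ i, ConvexSpace R (M i)]

lemma isAffineMap_update_left [DecidableEq I] (i : I) (x : M i) :
    IsAffineMap R fun f : ∀ i, M i => Function.update f i x :=
  isAffineMap_pi fun j => by
    obtain rfl | hj := eq_or_ne j i
    · simpa only [Function.update_self] using IsAffineMap.const x
    · simpa only [Function.update_of_ne hj] using Pi.isAffineMap_eval

lemma isAffineMap_update_right [DecidableEq I] (f : ∀ i, M i) (i : I) :
    IsAffineMap R fun x : M i => Function.update f i x :=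
  isAffineMap_pi fun j => by
    obtain rfl | hj := eq_or_ne j i
    · simpa only [Function.update_self] using! IsAffineMap.id
    · simpa only [Function.update_of_ne hj] using IsAffineMap.const (f j)

lemma convexHull_finset_pi (s : Finset I) (G : ∀ i, Set (M i)) :
    Convexity.convexHull R ((s : Set I).pi G) =
      (s : Set I).pi fun i => Convexity.convexHull R (G i) := by
  classical
  refine (convexHull_min (Set.pi_mono fun i _ => subset_convexHull_self)
    (IsConvexSet.pi fun i _ => .convexHull)).antisymm ?_
  induction s using Finset.induction_on with
  | empty => simp
  | insert a s ha ih =>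
    rw [Finset.coe_insert]
    have update_mem : ∀ g ∈ (s : Set I).pi G, ∀ x ∈ Convexity.convexHull R (G a),
        Function.update g a x ∈ Convexity.convexHull R ((insert a (s : Set I)).pi G) := by
      intro g hg x hx
      refine mapsTo_convexHull (isAffineMap_update_right g a)
        (fun y hy => subset_convexHull_self ?_) hx
      refine Set.insert_pi a s G ▸ ⟨by simpa using hy, fun i hi => ?_⟩
      simpa [ne_of_mem_of_not_mem hi ha] using hg i hi
    intro f hf
    have hfa : f a ∈ Convexity.convexHull R (G a) := hf a (Set.mem_insert _ _)
    rw [← Function.update_eq_self a f]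
    exact mapsTo_convexHull (isAffineMap_update_left a (f a)) (fun g hg => update_mem g hg _ hfa)
      (ih fun i hi => hf i (Set.mem_insert_of_mem _ hi))

end ConvexHullPi

section MinkowskiSum

variable {R I J M N : Type*} [PartialOrder R] [Semiring R] [IsStrictOrderedRing R]
  [ConvexSpace R M] [ConvexSpace R N]

/-- The weighted Minkowski sum `∑ i, w i • G i`: all the convex combinations with weights `w` of
families that select a point of `G i` for every `i` in the support of `w`. It generalizes `wms`
from sets of distributions to indexed families of subsets of a convex space. -/
def minkowskiSum (w : StdSimplex R I) (G : I → Set M) : Set M :=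
  w.iConvexComb '' (w.weights.support : Set I).pi G

/-- The Kleisli extension of `G` for the monad of convex subsets of the distributions. -/
def minkowskiBind (S : Set (StdSimplex R I)) (G : I → Set M) : Set M :=
  ⋃ w ∈ S, minkowskiSum w G

variable {w : StdSimplex R I} {S T : Set (StdSimplex R I)} {G H : I → Set M} {x : M}

lemma mem_minkowskiSum : x ∈ minkowskiSum w G ↔
    ∃ g : I → M, (∀ i, w.weights i ≠ 0 → g i ∈ G i) ∧ w.iConvexComb g = x := by
  simp [minkowskiSum, Set.mem_pi]

lemma mem_minkowskiBind : x ∈ minkowskiBind S G ↔ ∃ w ∈ S, x ∈ minkowskiSum w G := by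
  simp [minkowskiBind]

lemma iConvexComb_mem_minkowskiSum {g : I → M} (hg : ∀ i, w.weights i ≠ 0 → g i ∈ G i) :
    w.iConvexComb g ∈ minkowskiSum w G :=
  mem_minkowskiSum.2 ⟨g, hg, rfl⟩

lemma minkowskiSum_subset_minkowskiBind (hw : w ∈ S) : minkowskiSum w G ⊆ minkowskiBind S G :=
  Set.subset_biUnion_of_mem (u := fun w => minkowskiSum w G) hw

lemma minkowskiSum_mono (h : ∀ i, G i ⊆ H i) : minkowskiSum w G ⊆ minkowskiSum w H :=
  Set.image_mono (Set.pi_mono fun i _ => h i)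

lemma minkowskiBind_mono (hST : S ⊆ T) (h : ∀ i, G i ⊆ H i) :
    minkowskiBind S G ⊆ minkowskiBind T H :=
  Set.biUnion_mono hST fun _ _ => minkowskiSum_mono h

lemma nonempty_minkowskiSum (w : StdSimplex R I) (hG : ∀ i, (G i).Nonempty) :
    (minkowskiSum w G).Nonempty :=
  (Set.pi_nonempty_iff.2 fun i => (hG i).imp fun _ hx _ => hx).image _

lemma nonempty_minkowskiBind (hS : S.Nonempty) (hG : ∀ i, (G i).Nonempty) :
    (minkowskiBind S G).Nonempty :=
  hS.elim fun w hw => (nonempty_minkowskiSum w hG).mono (minkowskiSum_subset_minkowskiBind hw)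

lemma exists_selection_of_mem_minkowskiSum (hG : ∀ i, (G i).Nonempty) (hx : x ∈ minkowskiSum w G) :
    ∃ g : I → M, (∀ i, g i ∈ G i) ∧ w.iConvexComb g = x := by
  classical
  obtain ⟨g, hg, rfl⟩ := mem_minkowskiSum.1 hx
  refine ⟨fun i => if w.weights i = 0 then (hG i).some else g i, fun i => ?_, ?_⟩
  · dsimp only
    split_ifs with hi
    exacts [(hG i).some_mem, hg i hi]
  · exact iConvexComb_congr fun i hi => if_neg hi

@[simp]
lemma minkowskiSum_single (i : I) (G : I → Set M) :
    minkowskiSum (StdSimplex.single i : StdSimplex R I) G = G i := by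
  ext x
  simp only [mem_minkowskiSum]
  refine ⟨?_, fun hx => ⟨fun _ => x, ?_, by simp⟩⟩
  · rintro ⟨g, hg, rfl⟩
    simpa using hg i (by simp)
  · intro j hj
    obtain rfl : i = j := by by_contra h; simp [h] at hj
    exact hx

lemma image_minkowskiSum {f : M → N} (hf : IsAffineMap R f) (w : StdSimplex R I) (G : I → Set M) :
    f '' minkowskiSum w G = minkowskiSum w fun i => f '' G i := by
  ext y
  simp only [mem_minkowskiSum, Set.mem_image]
  constructor
  · rintro ⟨_, ⟨g, hg, rfl⟩, rfl⟩
    exact ⟨f ∘ g, fun i hi => ⟨g i, hg i hi, rfl⟩, (hf.map_iConvexComb w g).symm⟩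
  · rintro ⟨h, hh, rfl⟩
    obtain ⟨g, hg⟩ := exists_forall_weights_ne_zero_imp w hh
    exact ⟨_, ⟨g, fun i hi => (hg i hi).1, rfl⟩,
      (hf.map_iConvexComb w g).trans (iConvexComb_congr fun i hi => (hg i hi).2)⟩

lemma image_minkowskiBind {f : M → N} (hf : IsAffineMap R f) (S : Set (StdSimplex R I))
    (G : I → Set M) : f '' minkowskiBind S G = minkowskiBind S fun i => f '' G i := by
  simp only [minkowskiBind, Set.image_iUnion₂, image_minkowskiSum hf]

lemma finite_minkowskiSum (hG : ∀ i, (G i).Finite) : (minkowskiSum w G).Finite := by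
  obtain h | ⟨_, g₀, -, -⟩ := (minkowskiSum w G).eq_empty_or_nonempty
  · exact h ▸ Set.finite_empty
  classical
  let extend (g : w.weights.support → M) (i : I) : M :=
    if hi : i ∈ w.weights.support then g ⟨i, hi⟩ else g₀ i
  refine ((Set.Finite.pi' fun i : w.weights.support => hG i).image
    fun g => w.iConvexComb (extend g)).subset ?_
  rintro _ ⟨g, hg, rfl⟩
  exact ⟨fun i => g i, fun i => hg i i.2,
    iConvexComb_congr fun i hi => dif_pos (Finsupp.mem_support_iff.2 hi)⟩

lemma finite_minkowskiBind (hS : S.Finite) (hG : ∀ i, (G i).Finite) :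
    (minkowskiBind S G).Finite :=
  hS.biUnion fun _ _ => finite_minkowskiSum hG

end MinkowskiSum

lemma convexHull_minkowskiSum {R I M : Type*} [PartialOrder R] [CommSemiring R]
    [IsStrictOrderedRing R] [ConvexSpace R M] (w : StdSimplex R I) (G : I → Set M) :
    Convexity.convexHull R (minkowskiSum w G) =
      minkowskiSum w fun i => Convexity.convexHull R (G i) := by
  rw [minkowskiSum, minkowskiSum, ← convexHull_finset_pi,
    (isAffineMap_iConvexComb_right w).image_convexHull]

section MinkowskiSumOfConvex

variable {K I J M : Type*} [Semifield K] [LinearOrder K] [IsStrictOrderedRing K]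
  [ConvexSpace K M]

lemma minkowskiSum_map {G : J → Set M} {f : I → J} (hG : ∀ i, IsConvexSet K (G (f i)))
    (w : StdSimplex K I) : minkowskiSum (w.map f) G = minkowskiSum w fun i => G (f i) := by
  ext x
  simp only [mem_minkowskiSum]
  constructor
  · rintro ⟨g, hg, rfl⟩
    exact ⟨fun i => g (f i), fun i hi => hg _ (weights_map_ne_zero_iff.2 ⟨i, rfl, hi⟩),
      (iConvexComb_map w f g).symm⟩
  · rintro ⟨g, hg, rfl⟩
    refine ⟨fun j => (fibre w f j).iConvexComb g, fun j hj => ?_, ?_⟩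
    · obtain ⟨i, rfl, -⟩ := weights_map_ne_zero_iff.1 hj
      refine (hG i).iConvexComb_mem fun i' hi' => ?_
      obtain ⟨hfi', hwi'⟩ := (weights_fibre_ne_zero_iff hj).1 hi'
      exact hfi' ▸ hg i' hwi'
    · rw [iConvexComb_assoc, iConvexComb_fibre]

lemma minkowskiSum_compProd (w : StdSimplex K I) (Φ : I → StdSimplex K J) (G : I × J → Set M) :
    minkowskiSum (compProd w Φ) G =
      minkowskiSum w fun i => minkowskiSum (Φ i) fun j => G (i, j) := by
  ext x
  simp only [mem_minkowskiSum, weights_compProd, mul_ne_zero_iff, iConvexComb_compProd]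
  constructor
  · rintro ⟨h, hh, rfl⟩
    exact ⟨fun i => (Φ i).iConvexComb fun j => h (i, j),
      fun i hi => ⟨fun j => h (i, j), fun j hj => hh (i, j) ⟨hi, hj⟩, rfl⟩, rfl⟩
  · rintro ⟨g, hg, rfl⟩
    obtain ⟨h, hh⟩ := exists_forall_weights_ne_zero_imp w hg
    exact ⟨fun p => h p.1 p.2, fun p hp => (hh p.1 hp.1).1 p.2 hp.2,
      iConvexComb_congr fun i hi => (hh i hi).2⟩

lemma minkowskiSum_iConvexComb {G : J → Set M} (hG : ∀ j, IsConvexSet K (G j))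
    (w : StdSimplex K I) (Φ : I → StdSimplex K J) :
    minkowskiSum (w.iConvexComb Φ) G = minkowskiSum w fun i => minkowskiSum (Φ i) G := by
  rw [← map_snd_compProd, minkowskiSum_map fun _ => hG _, minkowskiSum_compProd]

lemma minkowskiBind_minkowskiSum {G : J → Set M} (hG : ∀ j, IsConvexSet K (G j))
    (w : StdSimplex K I) (S : I → Set (StdSimplex K J)) :
    minkowskiBind (minkowskiSum w S) G = minkowskiSum w fun i => minkowskiBind (S i) G := by
  ext x
  simp only [mem_minkowskiBind]
  constructor
  · rintro ⟨_, hΨ, hx⟩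
    obtain ⟨Φ, hΦ, rfl⟩ := mem_minkowskiSum.1 hΨ
    rw [minkowskiSum_iConvexComb hG] at hx
    obtain ⟨g, hg, rfl⟩ := mem_minkowskiSum.1 hx
    exact iConvexComb_mem_minkowskiSum fun i hi =>
      minkowskiSum_subset_minkowskiBind (hΦ i hi) (hg i hi)
  · intro hx
    obtain ⟨g, hg, rfl⟩ := mem_minkowskiSum.1 hx
    simp only [mem_minkowskiBind] at hg
    obtain ⟨Φ, hΦ⟩ := exists_forall_weights_ne_zero_imp w hg
    refine ⟨w.iConvexComb Φ, iConvexComb_mem_minkowskiSum fun i hi => (hΦ i hi).1, ?_⟩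
    rw [minkowskiSum_iConvexComb hG]
    exact iConvexComb_mem_minkowskiSum fun i hi => (hΦ i hi).2

lemma minkowskiBind_assoc {H : J → Set M} (hH : ∀ j, IsConvexSet K (H j))
    (S : Set (StdSimplex K I)) (G : I → Set (StdSimplex K J)) :
    minkowskiBind (minkowskiBind S G) H = minkowskiBind S fun i => minkowskiBind (G i) H := by
  simp only [minkowskiBind.eq_def S, ← minkowskiBind_minkowskiSum hH]
  simp only [minkowskiBind, Set.biUnion_iUnion]

lemma minkowskiBind_image_map {G : J → Set M} {f : I → J} (hG : ∀ i, IsConvexSet K (G (f i)))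
    (S : Set (StdSimplex K I)) :
    minkowskiBind (StdSimplex.map f '' S) G = minkowskiBind S fun i => G (f i) := by
  simp only [minkowskiBind, Set.biUnion_image, minkowskiSum_map hG]

lemma isConvexSet_minkowskiBind {S : Set (StdSimplex K I)} (hS : IsConvexSet K S) {G : I → Set M}
    (hG : ∀ i, IsConvexSet K (G i)) : IsConvexSet K (minkowskiBind S G) := by
  intro W hW
  obtain ⟨w, hw⟩ := exists_forall_weights_ne_zero_imp W fun x hx =>
    mem_minkowskiBind.1 (hW (Finsupp.mem_support_iff.2 hx))
  refine mem_minkowskiBind.2 ⟨W.iConvexComb w, hS.iConvexComb_mem fun x hx => (hw x hx).1, ?_⟩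
  rw [minkowskiSum_iConvexComb hG, ← iConvexComb_id]
  exact iConvexComb_mem_minkowskiSum fun x hx => (hw x hx).2

end MinkowskiSumOfConvex

lemma convexHull_minkowskiBind {K I M : Type*} [Field K] [LinearOrder K] [IsStrictOrderedRing K]
    [ConvexSpace K M] (B : Set (StdSimplex K I)) {G : I → Set M} (hG : ∀ i, (G i).Nonempty) :
    Convexity.convexHull K (minkowskiBind B G) =
      minkowskiBind (Convexity.convexHull K B) fun i => Convexity.convexHull K (G i) := by
  refine (convexHull_min (minkowskiBind_mono subset_convexHull_self fun _ =>
    subset_convexHull_self) (isConvexSet_minkowskiBind .convexHull fun _ => .convexHull)).antisymm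
    (Set.iUnion₂_subset fun w hw => ?_)
  rw [← convexHull_minkowskiSum]
  refine convexHull_min (fun x hx => ?_) .convexHull
  obtain ⟨g, hg, rfl⟩ := exists_selection_of_mem_minkowskiSum hG hx
  refine mapsTo_convexHull (isAffineMap_iConvexComb_left g)
    (fun v hv => subset_convexHull_self ?_) hw
  exact minkowskiSum_subset_minkowskiBind hv (iConvexComb_mem_minkowskiSum fun i _ => hg i)

section Kantorovich

variable {A : Type u} {d : A → A → ℝ} {φ ψ : Distr A}

lemma coup_nonempty (φ ψ : Distr A) : (Coup φ ψ).Nonempty :=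
  ⟨compProd φ fun _ => ψ, map_fst_compProd _ _, by rw [map_snd_compProd, iConvexComb_const]⟩

lemma kantorovich_eq_iInf_iConvexComb (φ ψ : Distr A) :
    kantorovich d φ ψ = ⨅ ω : Coup φ ψ, ω.1.iConvexComb fun p => d p.1 p.2 := by
  simp only [kantorovich, iConvexComb_eq_sum, smul_eq_mul]

lemma exists_coup_lt {r : ℝ} (h : kantorovich d φ ψ < r) :
    ∃ ω ∈ Coup φ ψ, (ω.iConvexComb fun p => d p.1 p.2) < r := by
  rw [kantorovich_eq_iInf_iConvexComb] at h
  have := (coup_nonempty φ ψ).to_subtype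
  obtain ⟨ω, hω⟩ := exists_lt_of_ciInf_lt h
  exact ⟨ω.1, ω.2, hω⟩

lemma le_kantorovich {r : ℝ} (h : ∀ ω ∈ Coup φ ψ, r ≤ ω.iConvexComb fun p => d p.1 p.2) :
    r ≤ kantorovich d φ ψ := by
  refine le_of_forall_gt fun c hc => ?_
  obtain ⟨ω, hω, hlt⟩ := exists_coup_lt hc
  exact (h ω hω).trans_lt hlt

lemma iConvexComb_nonneg {I : Type*} (w : StdSimplex ℝ I) {f : I → ℝ} (hf : ∀ i, 0 ≤ f i) :
    0 ≤ w.iConvexComb f := by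
  simpa only [iConvexComb_const] using iConvexComb_mono (w := w) fun i _ => hf i

lemma kantorovich_nonneg (h0 : ∀ a b, 0 ≤ d a b) (φ ψ : Distr A) : 0 ≤ kantorovich d φ ψ :=
  le_kantorovich fun ω _ => iConvexComb_nonneg ω fun _ => h0 _ _

lemma kantorovich_map_map_le (h0 : ∀ a b, 0 ≤ d a b) {I : Type*} (w : StdSimplex ℝ I)
    (f g : I → A) :
    kantorovich d (w.map f) (w.map g) ≤ w.iConvexComb fun i => d (f i) (g i) := by
  have coup : w.map (fun i => (f i, g i)) ∈ Coup (w.map f) (w.map g) := by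
    simp [Coup, StdSimplex.map_map]
  rw [kantorovich_eq_iInf_iConvexComb, ← iConvexComb_map w (fun i => (f i, g i)) fun p => d p.1 p.2]
  refine ciInf_le ⟨0, ?_⟩ (⟨_, coup⟩ : Coup _ _)
  rintro _ ⟨ω, rfl⟩
  exact iConvexComb_nonneg _ fun _ => h0 _ _

lemma kantorovich_self (h0 : ∀ a b, 0 ≤ d a b) (hd : ∀ a, d a a = 0) (φ : Distr A) :
    kantorovich d φ φ = 0 := by
  refine le_antisymm ?_ (kantorovich_nonneg h0 φ φ)
  simpa only [StdSimplex.map_id, id, hd, iConvexComb_const] using kantorovich_map_map_le h0 φ id id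

lemma kantorovich_map_le {B : Type u} {e : B → B → ℝ} (h0 : ∀ a b, 0 ≤ e a b) {f : A → B}
    (hf : ∀ a b, e (f a) (f b) ≤ d a b) (φ ψ : Distr A) :
    kantorovich e (φ.map f) (ψ.map f) ≤ kantorovich d φ ψ := by
  refine le_kantorovich ?_
  rintro ω ⟨rfl, rfl⟩
  rw [StdSimplex.map_map, StdSimplex.map_map]
  exact (kantorovich_map_map_le h0 ω _ _).trans (iConvexComb_mono fun p _ => hf _ _)

lemma kantorovich_comm (h0 : ∀ a b, 0 ≤ d a b) (hs : ∀ a b, d a b = d b a) (φ ψ : Distr A) :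
    kantorovich d φ ψ = kantorovich d ψ φ := by
  have le_swap (φ ψ : Distr A) : kantorovich d φ ψ ≤ kantorovich d ψ φ := by
    refine le_kantorovich ?_
    rintro ω ⟨rfl, rfl⟩
    exact (kantorovich_map_map_le h0 ω _ _).trans (iConvexComb_mono fun p _ => (hs _ _).le)
  exact (le_swap φ ψ).antisymm (le_swap ψ φ)

lemma kantorovich_triangle (h0 : ∀ a b, 0 ≤ d a b) (ht : ∀ a b c, d a b ≤ d a c + d c b)
    (φ ψ χ : Distr A) : kantorovich d φ ψ ≤ kantorovich d φ χ + kantorovich d χ ψ := by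
  refine le_of_forall_pos_lt_add fun ε hε => ?_
  obtain ⟨ω, ⟨rfl, hωχ⟩, hω⟩ :=
    exists_coup_lt (lt_add_of_pos_right (kantorovich d φ χ) (half_pos hε))
  obtain ⟨ω', ⟨hω'χ, rfl⟩, hω'⟩ :=
    exists_coup_lt (lt_add_of_pos_right (kantorovich d χ ψ) (half_pos hε))
  obtain ⟨τ, rfl, rfl, hτ⟩ := exists_coupling_of_map_eq (hωχ.trans hω'χ.symm)
  simp only [StdSimplex.map_map, iConvexComb_map] at hω hω' ⊢
  calc _ ≤ τ.iConvexComb fun p => d p.1.1 p.2.2 := kantorovich_map_map_le h0 τ _ _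
    _ ≤ τ.iConvexComb fun p => d p.1.1 p.1.2 + d p.2.1 p.2.2 :=
      iConvexComb_mono fun p hp => hτ p hp ▸ ht _ _ _
    _ < _ := by rw [iConvexComb_add]; linarith

lemma kantorovich_le_one (h0 : ∀ a b, 0 ≤ d a b) (h1 : ∀ a b, d a b ≤ 1) (φ ψ : Distr A) :
    kantorovich d φ ψ ≤ 1 := by
  obtain ⟨ω, rfl, rfl⟩ := coup_nonempty φ ψ
  refine (kantorovich_map_map_le h0 ω _ _).trans ?_
  simpa only [iConvexComb_const] using iConvexComb_mono (w := ω) fun p _ => h1 p.1 p.2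

lemma kantorovich_iConvexComb_le (h0 : ∀ a b, 0 ≤ d a b) {I : Type*} (w : StdSimplex ℝ I)
    (φ ψ : I → Distr A) :
    kantorovich d (w.iConvexComb φ) (w.iConvexComb ψ) ≤
      w.iConvexComb fun i => kantorovich d (φ i) (ψ i) := by
  refine le_of_forall_pos_le_add fun ε hε => ?_
  choose ω hω hlt using fun i => exists_coup_lt (lt_add_of_pos_right (kantorovich d (φ i) (ψ i)) hε)
  obtain rfl : (fun i => (ω i).map Prod.fst) = φ := funext fun i => (hω i).1
  obtain rfl : (fun i => (ω i).map Prod.snd) = ψ := funext fun i => (hω i).2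
  have map_comb (f : A × A → A) : w.iConvexComb (fun i => (ω i).map f) = (w.iConvexComb ω).map f :=
    (map_iConvexComb ..).symm
  rw [map_comb, map_comb]
  calc _ ≤ (w.iConvexComb ω).iConvexComb fun p => d p.1 p.2 := kantorovich_map_map_le h0 _ _ _
    _ = w.iConvexComb fun i => (ω i).iConvexComb fun p => d p.1 p.2 := (iConvexComb_assoc ..).symm
    _ ≤ w.iConvexComb fun i => kantorovich d ((ω i).map Prod.fst) ((ω i).map Prod.snd) + ε :=
      iConvexComb_mono fun i _ => (hlt i).le
    _ = _ := by rw [iConvexComb_add, iConvexComb_const]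

lemma abs_iConvexComb_sub_le_kantorovich {f : A → ℝ}
    (hf : ∀ a b, φ.weights a ≠ 0 → ψ.weights b ≠ 0 → |f a - f b| ≤ d a b) :
    |φ.iConvexComb f - ψ.iConvexComb f| ≤ kantorovich d φ ψ := by
  refine le_kantorovich ?_
  rintro ω ⟨rfl, rfl⟩
  have hωf (p : A × A) (hp : ω.weights p ≠ 0) : |f p.1 - f p.2| ≤ d p.1 p.2 :=
    hf _ _ (weights_map_ne_zero_iff.2 ⟨p, rfl, hp⟩) (weights_map_ne_zero_iff.2 ⟨p, rfl, hp⟩)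
  rw [iConvexComb_map, iConvexComb_map, abs_sub_le_iff, sub_le_iff_le_add, sub_le_iff_le_add,
    ← iConvexComb_add, ← iConvexComb_add]
  exact ⟨iConvexComb_mono fun p hp => sub_le_iff_le_add.1 (abs_sub_le_iff.1 (hωf p hp)).1,
    iConvexComb_mono fun p hp => sub_le_iff_le_add.1 (abs_sub_le_iff.1 (hωf p hp)).2⟩

end Kantorovich

section Hausdorff

variable {A : Type u} {d : A → A → ℝ} {S T : Set A}

lemma hausdorff_nonneg (h0 : ∀ a b, 0 ≤ d a b) (S T : Set A) : 0 ≤ hausdorff d S T :=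
  le_max_of_le_left (Real.iSup_nonneg fun _ => Real.iInf_nonneg fun _ => h0 _ _)

lemma hausdorff_comm (hs : ∀ a b, d a b = d b a) (S T : Set A) :
    hausdorff d S T = hausdorff d T S := by
  simp only [hausdorff, max_comm, hs]

lemma exists_lt_hausdorff_add (h0 : ∀ a b, 0 ≤ d a b) (h1 : ∀ a b, d a b ≤ 1) (hT : T.Nonempty)
    {s : A} (hs : s ∈ S) {ε : ℝ} (hε : 0 < ε) : ∃ t ∈ T, d s t < hausdorff d S T + ε := by
  have := hT.to_subtype
  have bddBelow (s : S) : BddBelow (Set.range fun t : T => d s t) :=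
    ⟨0, Set.forall_mem_range.2 fun _ => h0 _ _⟩
  have bddAbove : BddAbove (Set.range fun s : S => ⨅ t : T, d s t) :=
    ⟨1, Set.forall_mem_range.2 fun s => (ciInf_le (bddBelow s) (Classical.arbitrary T)).trans
      (h1 _ _)⟩
  have h : (⨅ t : T, d s t) < hausdorff d S T + ε :=
    ((le_ciSup bddAbove ⟨s, hs⟩).trans (le_max_left _ _)).trans_lt (lt_add_of_pos_right _ hε)
  obtain ⟨t, ht⟩ := exists_lt_of_ciInf_lt h
  exact ⟨t, t.2, ht⟩

lemma ciSup_ciInf_le (h0 : ∀ a b, 0 ≤ d a b) (hS : S.Nonempty) {r : ℝ}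
    (h : ∀ s ∈ S, ∀ ε > 0, ∃ t ∈ T, d s t ≤ r + ε) : ⨆ s : S, ⨅ t : T, d s t ≤ r := by
  have := hS.to_subtype
  refine ciSup_le fun s => le_of_forall_pos_le_add fun ε hε => ?_
  obtain ⟨t, ht, hle⟩ := h s s.2 ε hε
  exact (ciInf_le ⟨0, Set.forall_mem_range.2 fun _ => h0 _ _⟩ (⟨t, ht⟩ : T)).trans hle

lemma hausdorff_le_of_forall_exists_le (h0 : ∀ a b, 0 ≤ d a b) (hs : ∀ a b, d a b = d b a)
    {ι : Type*} {D : ι → Set A} (hD : ∀ i, (D i).Nonempty) {r : ι → ι → ℝ}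
    (hr : ∀ i j, r i j = r j i)
    (h : ∀ i j, ∀ a ∈ D i, ∀ ε > 0, ∃ b ∈ D j, d a b ≤ r i j + ε) (i j : ι) :
    hausdorff d (D i) (D j) ≤ r i j := by
  refine max_le (ciSup_ciInf_le h0 (hD i) (h i j)) ?_
  simp only [hs (_ : D i)]
  exact hr i j ▸ ciSup_ciInf_le h0 (hD j) (h j i)

lemma IsOneBoundedMetric.hausdorff (hd : IsOneBoundedMetric d) {ι : Type u} {D : ι → Set A}
    (hinj : Function.Injective D) (hD : ∀ i, (D i).Nonempty)
    (hclosed : ∀ i a, (∀ ε > 0, ∃ b ∈ D i, d a b < ε) → a ∈ D i) :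
    IsOneBoundedMetric fun i j => hausdorff d (D i) (D j) := by
  have symm (i j) := hausdorff_comm hd.symm (D i) (D j)
  have near {i : ι} (j : ι) {a : A} (ha : a ∈ D i) {ε : ℝ} (hε : 0 < ε) :=
    exists_lt_hausdorff_add hd.nonneg hd.le_one (hD j) ha hε
  have subset {i j} (h : _root_.hausdorff d (D i) (D j) = 0) : D i ⊆ D j := fun a ha =>
    hclosed j a fun ε hε => by simpa only [h, zero_add] using near j ha hε
  exact {
    nonneg i j := hausdorff_nonneg hd.nonneg _ _
    le_one := hausdorff_le_of_forall_exists_le hd.nonneg hd.symm hD (fun _ _ => rfl)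
      fun i j a _ ε hε => ⟨_, (hD j).some_mem, (hd.le_one _ _).trans (by linarith)⟩
    eq_zero_iff i j := by
      refine ⟨fun h => hinj ((subset h).antisymm (subset (symm j i ▸ h))), ?_⟩
      rintro rfl
      refine (hausdorff_le_of_forall_exists_le hd.nonneg hd.symm (fun _ : Unit => hD i)
        (r := fun _ _ => 0) (fun _ _ => rfl) (fun _ _ a ha ε hε => ⟨a, ha, ?_⟩) () ()).antisymm
          (hausdorff_nonneg hd.nonneg _ _)
      simpa only [(hd.eq_zero_iff a a).2 rfl, zero_add] using hε.le
    symm := symm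
    triangle i j k := by
      refine hausdorff_le_of_forall_exists_le hd.nonneg hd.symm hD
        (r := fun i j => _root_.hausdorff d (D i) (D k) + _root_.hausdorff d (D k) (D j))
        (fun i j => ?_) (fun i j a ha ε hε => ?_) i j
      · rw [symm i k, symm k j, add_comm]
      · obtain ⟨c, hc, hac⟩ := near k ha (half_pos hε)
        obtain ⟨b, hb, hcb⟩ := near j hc (half_pos hε)
        exact ⟨b, hb, (hd.triangle a b c).trans (by linarith)⟩ }

end Hausdorff

section ConvexHullModule

variable {K E : Type*} [Field K] [LinearOrder K] [IsStrictOrderedRing K] [AddCommGroup E]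
  [Module K E] [ConvexSpace K E] [IsModuleConvexSpace K E]

lemma isConvexSet_iff_convex {s : Set E} : IsConvexSet K s ↔ Convex K s := by
  refine ⟨fun h x hx y hy a b ha hb hab => ?_, fun h => .of_convexCombPair_mem
    fun a b ha hb hab x hx y hy => ?_⟩
  · simpa only [convexCombPair_eq_sum] using h.convexCombPair_mem hx hy ha hb hab
  · simpa only [convexCombPair_eq_sum] using h hx hy ha hb hab

lemma convexHull_eq_moduleConvexHull (s : Set E) :
    Convexity.convexHull K s = _root_.convexHull K s :=
  (convexHull_min (_root_.subset_convexHull K s)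
    (isConvexSet_iff_convex.2 (convex_convexHull K s))).antisymm
    (_root_.convexHull_min subset_convexHull_self (isConvexSet_iff_convex.1 .convexHull))

end ConvexHullModule

section Closed

open Filter Topology

variable {A : Type u} {d : A → A → ℝ}

lemma isAffineMap_coe_weights : IsAffineMap ℝ fun φ : Distr A => (φ.weights : A → ℝ) :=
  isAffineMap_pi fun _ => Finsupp.isAffineMap_eval.comp (StdSimplex.isAffineMap_weights ℝ A)

lemma isClosed_image_weights_convexHull {B : Set (Distr A)} (hB : B.Finite) :
    IsClosed ((fun φ : Distr A => (φ.weights : A → ℝ)) '' Convexity.convexHull ℝ B) := by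
  rw [isAffineMap_coe_weights.image_convexHull, convexHull_eq_moduleConvexHull]
  exact ((hB.image _).isCompact_convexHull ℝ).isClosed

lemma support_subset_of_mem_convexHull {B : Set (Distr A)} {F : Set A}
    (hF : ∀ φ ∈ B, (φ.weights.support : Set A) ⊆ F) {φ : Distr A}
    (hφ : φ ∈ Convexity.convexHull ℝ B) : (φ.weights.support : Set A) ⊆ F := by
  refine mem_convexHull_iff.1 hφ {φ | (φ.weights.support : Set A) ⊆ F} hF fun W hW a ha => ?_
  have ha : (W.iConvexComb id).weights a ≠ 0 := by
    rw [iConvexComb_id]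
    exact Finsupp.mem_support_iff.1 ha
  contrapose! ha
  rw [weights_iConvexComb_apply]
  refine (iConvexComb_congr fun ψ hψ => ?_).trans (iConvexComb_const W 0)
  exact Finsupp.notMem_support_iff.1 fun h => ha (hW (Finsupp.mem_support_iff.2 hψ) h)

lemma IsOneBoundedMetric.exists_pos_forall_le (hd : IsOneBoundedMetric d) (F : Finset A) (a : A) :
    ∃ δ > 0, ∀ b ∈ F, b ≠ a → δ ≤ d a b := by
  have small : ∀ᶠ δ in 𝓝[>] (0 : ℝ), ∀ b ∈ F, b ≠ a → δ ≤ d a b := by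
    refine (eventually_all_finset F).2 fun b _ => eventually_imp_distrib_left.2 fun hb => ?_
    have : 0 < d a b := (hd.nonneg a b).lt_of_ne fun h => hb ((hd.eq_zero_iff a b).1 h.symm).symm
    exact (eventually_le_nhds this).filter_mono nhdsWithin_le_nhds
  obtain ⟨δ, hδ, h⟩ := (eventually_mem_nhdsWithin.and small).exists
  exact ⟨δ, hδ, h⟩

lemma mul_abs_weights_sub_le_kantorovich (h0 : ∀ a b, 0 ≤ d a b) {φ ψ : Distr A} {a : A}
    {δ : ℝ} (hδ : 0 ≤ δ) (hφ : ∀ b, φ.weights b ≠ 0 → b ≠ a → δ ≤ d b a)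
    (hψ : ∀ b, ψ.weights b ≠ 0 → b ≠ a → δ ≤ d a b) :
    δ * |φ.weights a - ψ.weights a| ≤ kantorovich d φ ψ := by
  classical
  nth_rw 1 [← abs_of_nonneg hδ]
  rw [mul_comm, ← abs_mul, sub_mul, ← iConvexComb_piSingle, ← iConvexComb_piSingle]
  refine abs_iConvexComb_sub_le_kantorovich fun b c hb hc => ?_
  obtain rfl | hba := eq_or_ne b a <;> obtain rfl | hcb := eq_or_ne c b
  · simpa using h0 c c
  · simpa [hcb, abs_of_nonneg hδ] using hψ c hc hcb
  · simpa using h0 c c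
  · obtain rfl | hca := eq_or_ne c a
    · simpa [hba, abs_of_nonneg hδ] using hφ b hb hba
    · simpa [hba, hca] using h0 b c

lemma tendsto_weights_of_tendsto_kantorovich (hd : IsOneBoundedMetric d) {ι : Type*}
    {l : Filter ι} {φ : Distr A} {ψ : ι → Distr A} {F : Finset A}
    (hF : ∀ i, (ψ i).weights.support ⊆ F)
    (h : Tendsto (fun i => kantorovich d φ (ψ i)) l (𝓝 0)) :
    Tendsto (fun i => ((ψ i).weights : A → ℝ)) l (𝓝 φ.weights) := by
  classical
  refine tendsto_pi_nhds.2 fun a => tendsto_iff_dist_tendsto_zero.2 ?_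
  obtain ⟨δ, hδ, far⟩ := hd.exists_pos_forall_le (F ∪ φ.weights.support) a
  refine squeeze_zero (fun _ => dist_nonneg) (fun i => ?_) (by simpa using h.const_mul δ⁻¹)
  rw [dist_comm, Real.dist_eq, le_inv_mul_iff₀ hδ]
  refine mul_abs_weights_sub_le_kantorovich hd.nonneg hδ.le
    (fun b hb => hd.symm a b ▸ far b ?_) fun b hb => far b ?_
  · exact Finset.mem_union_right _ (Finsupp.mem_support_iff.2 hb)
  · exact Finset.mem_union_left _ (hF i (Finsupp.mem_support_iff.2 hb))

lemma IsFGConvex.mem_of_forall_exists_kantorovich_lt {S : Set (Distr A)} (hS : IsFGConvex S)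
    (hd : IsOneBoundedMetric d) {φ : Distr A} (h : ∀ ε > 0, ∃ ψ ∈ S, kantorovich d φ ψ < ε) :
    φ ∈ S := by
  classical
  obtain ⟨B, hB, rfl⟩ := hS.finGen
  let F := hB.toFinset.biUnion fun χ => χ.weights.support
  have support_subset {ψ} (hψ : ψ ∈ Convexity.convexHull ℝ B) : ψ.weights.support ⊆ F :=
    Finset.coe_subset.1 <| support_subset_of_mem_convexHull (fun χ hχ => Finset.coe_subset.2 <|
      Finset.subset_biUnion_of_mem (fun χ : Distr A => χ.weights.support)
        (hB.mem_toFinset.2 hχ)) hψ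
  choose ψ hψ hlt using fun n : ℕ => h (1 / (n + 1)) (by positivity)
  have lim : Tendsto (fun n => kantorovich d φ (ψ n)) atTop (𝓝 0) :=
    squeeze_zero (fun n => kantorovich_nonneg hd.nonneg _ _) (fun n => (hlt n).le)
      tendsto_one_div_add_atTop_nhds_zero_nat
  obtain ⟨χ, hχ, hχφ⟩ := (isClosed_image_weights_convexHull hB).mem_of_tendsto
    (tendsto_weights_of_tendsto_kantorovich hd (fun n => support_subset (hψ n)) lim)
    (.of_forall fun n => ⟨_, hψ n, rfl⟩)
  rwa [← StdSimplex.ext (DFunLike.coe_injective hχφ)]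

end Closed

section Metric

variable {A : Type u} {d : A → A → ℝ}

lemma isFGConvex_singleton (φ : Distr A) : IsFGConvex {φ} where
  nonempty := Set.singleton_nonempty φ
  convex := .singleton
  finGen := ⟨{φ}, Set.finite_singleton φ, by simp⟩

lemma IsOneBoundedMetric.kantorovich (hd : IsOneBoundedMetric d) :
    IsOneBoundedMetric (kantorovich d) where
  nonneg := kantorovich_nonneg hd.nonneg
  le_one := kantorovich_le_one hd.nonneg hd.le_one
  eq_zero_iff φ ψ := by
    refine ⟨fun h => ?_, ?_⟩
    · exact (isFGConvex_singleton ψ).mem_of_forall_exists_kantorovich_lt hd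
        fun ε hε => ⟨ψ, rfl, h ▸ hε⟩
    · rintro rfl
      exact kantorovich_self hd.nonneg (fun a => (hd.eq_zero_iff a a).2 rfl) φ
  symm := kantorovich_comm hd.nonneg hd.symm
  triangle := kantorovich_triangle hd.nonneg hd.triangle

lemma IsOneBoundedMetric.optionDist (hd : IsOneBoundedMetric d) :
    IsOneBoundedMetric (optionDist d) where
  nonneg a b := by cases a <;> cases b <;> simp [_root_.optionDist, hd.nonneg]
  le_one a b := by cases a <;> cases b <;> simp [_root_.optionDist, hd.le_one]
  eq_zero_iff a b := by cases a <;> cases b <;> simp [_root_.optionDist, hd.eq_zero_iff]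
  symm a b := by cases a <;> cases b <;> simp [_root_.optionDist, hd.symm]
  triangle a b c := by
    have one_le_add_one (x y) : d x y ≤ 1 + 1 := (hd.le_one x y).trans (by norm_num)
    cases a <;> cases b <;> cases c <;>
      simp [_root_.optionDist, hd.triangle, hd.nonneg, one_le_add_one]

lemma OneMet.isOneBoundedMetric (X : OneMet.{u}) :
    IsOneBoundedMetric fun x y : X.carrier => dist x y where
  nonneg _ _ := dist_nonneg
  le_one := X.dist_le_one
  eq_zero_iff _ _ := dist_eq_zero
  symm := dist_comm
  triangle a b c := dist_triangle a c b

lemma isOneBoundedMetric_hausKant (X : OneMet.{u}) : IsOneBoundedMetric (hausKant X) :=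
  X.isOneBoundedMetric.optionDist.kantorovich.hausdorff Subtype.val_injective
    (fun S => S.2.1.nonempty)
    fun S _ h => S.2.1.mem_of_forall_exists_kantorovich_lt X.isOneBoundedMetric.optionDist h

end Metric

section FGConvex

variable {A B : Type u} {S : Set (Distr A)}

lemma IsFGConvex.image_map (hS : IsFGConvex S) (f : A → B) :
    IsFGConvex (StdSimplex.map f '' S) where
  nonempty := hS.nonempty.image _
  convex := hS.convex.image (StdSimplex.isAffineMap_map ℝ f)
  finGen := by
    obtain ⟨G, hG, rfl⟩ := hS.finGen
    exact ⟨_, hG.image _, (StdSimplex.isAffineMap_map ℝ f).image_convexHull G⟩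

lemma IsFGConvex.minkowskiBind (hS : IsFGConvex S) {G : A → Set (Distr B)}
    (hG : ∀ a, IsFGConvex (G a)) : IsFGConvex (minkowskiBind S G) where
  nonempty := nonempty_minkowskiBind hS.nonempty fun a => (hG a).nonempty
  convex := isConvexSet_minkowskiBind hS.convex fun a => (hG a).convex
  finGen := by
    obtain ⟨C, hC, rfl⟩ := hS.finGen
    choose D hD hDG using fun a => (hG a).finGen
    obtain rfl : G = fun a => Convexity.convexHull ℝ (D a) := funext hDG
    exact ⟨_, finite_minkowskiBind hC hD, (convexHull_minkowskiBind C fun a =>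
      convexHull_nonempty.1 (hG a).nonempty).symm⟩

lemma isFGConvex_convexHull {C : Set (Distr A)} (hC : C.Finite) (hne : C.Nonempty) :
    IsFGConvex (Convexity.convexHull ℝ C) where
  nonempty := convexHull_nonempty.2 hne
  convex := .convexHull
  finGen := ⟨C, hC, rfl⟩

end FGConvex

section BotClosed

variable {A B : Type u} {φ ψ : Distr (Option A)} {S : Set (Distr (Option A))}

/-- The set of the subdistributions that are pointwise below `φ` on `A`. A set is `⊥`-closed if it
contains with every `φ` the set `Below φ`. -/
def Below (φ : Distr (Option A)) : Set (Distr (Option A)) :=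
  {ψ | ∀ a : A, ψ.weights (some a) ≤ φ.weights (some a)}

lemma self_mem_below (φ : Distr (Option A)) : φ ∈ Below φ := fun _ => le_rfl

lemma single_none_mem_below (φ : Distr (Option A)) : StdSimplex.single none ∈ Below φ := by
  simp [Below]

lemma isBotClosed_below (φ : Distr (Option A)) : IsBotClosed (Below φ) :=
  fun _ hψ _ hχ a => (hχ a).trans (hψ a)

lemma isConvexSet_below (φ : Distr (Option A)) : IsConvexSet ℝ (Below φ) := fun W hW a => by
  rw [← iConvexComb_id, weights_iConvexComb_apply]
  refine (iConvexComb_mono fun ψ hψ => ?_).trans_eq (iConvexComb_const W (φ.weights (some a)))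
  exact hW (Finsupp.mem_support_iff.2 hψ) a

lemma ext_some (h : ∀ a, φ.weights (some a) = ψ.weights (some a)) : φ = ψ := by
  classical
  have some_eq : φ.weights.some = ψ.weights.some := Finsupp.ext h
  have weights_none (χ : Distr (Option A)) :
      χ.weights none = 1 - χ.weights.some.sum fun _ r => r := by
    rw [eq_sub_iff_add_eq, ← χ.total, Finsupp.sum_option_index] <;> simp
  ext o
  cases o with
  | none => rw [weights_none, weights_none, some_eq]
  | some a => exact h a

lemma eq_duple_of_mem_below_single {o : Option A} (h : ψ ∈ Below (StdSimplex.single o)) :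
    ψ = StdSimplex.duple o none (ψ.weights_nonneg o) (sub_nonneg.2 (weights_le_one ψ o))
      (add_sub_cancel _ 1) := by
  refine ext_some fun a => ?_
  obtain rfl | hao := eq_or_ne o (some a)
  · simp
  · simpa [hao] using (h a).antisymm (by simp [hao])

lemma cdownUnit_eq_below (x : A) : cdownUnit x = Below (StdSimplex.single (some x)) := by
  refine Set.Subset.antisymm ?_ fun ψ hψ =>
    ⟨_, ψ.weights_nonneg _, weights_le_one ψ _, eq_duple_of_mem_below_single hψ⟩
  rintro _ ⟨p, hp₀, hp₁, rfl⟩ a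
  by_cases h : x = a <;> simp [h, hp₁]

lemma below_single (o : Option A) :
    Below (StdSimplex.single o) =
      Convexity.convexHull ℝ {StdSimplex.single o, StdSimplex.single none} := by
  refine Set.Subset.antisymm (fun ψ hψ => ?_) (convexHull_min ?_ (isConvexSet_below _))
  · have generators_mem := subset_convexHull_self (R := ℝ)
      (s := ({StdSimplex.single o, StdSimplex.single none} : Set (Distr (Option A))))
    have := IsConvexSet.convexHull.convexCombPair_mem (generators_mem (Set.mem_insert _ _))
      (generators_mem (Set.mem_insert_of_mem _ rfl)) (ψ.weights_nonneg o)
      (sub_nonneg.2 (weights_le_one ψ o)) (add_sub_cancel _ 1)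
    rw [eq_duple_of_mem_below_single hψ]
    convert this using 1
    ext1
    simp
  · rintro _ (rfl | rfl)
    exacts [self_mem_below _, single_none_mem_below _]

lemma below_single_none :
    Below (StdSimplex.single (none : Option A)) = {StdSimplex.single none} := by
  simp [below_single]

lemma isFGConvex_below_single (o : Option A) : IsFGConvex (Below (StdSimplex.single o)) :=
  below_single o ▸ isFGConvex_convexHull (Set.toFinite _) (Set.insert_nonempty _ _)

lemma cdownMap_below_single (f : A → B) (o : Option A) :
    cdownMap f (Below (StdSimplex.single o)) = Below (StdSimplex.single (o.map f)) := by
  rw [below_single, below_single, cdownMap, (StdSimplex.isAffineMap_map ℝ _).image_convexHull,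
    Set.image_pair, StdSimplex.map_single, StdSimplex.map_single, Option.map_none]

lemma minkowskiSum_below_single (φ : Distr (Option A)) :
    minkowskiSum φ (fun o => Below (StdSimplex.single o)) = Below φ := by
  classical
  refine Set.Subset.antisymm (fun ψ hψ a => ?_) fun ψ hψ => ?_
  · obtain ⟨g, hg, rfl⟩ := mem_minkowskiSum.1 hψ
    rw [weights_iConvexComb_apply, ← iConvexComb_single_eq_self φ, weights_iConvexComb_apply,
      iConvexComb_single_eq_self]
    exact iConvexComb_mono fun o ho => hg o ho a
  · let c (a : A) := ψ.weights (some a) / φ.weights (some a)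
    have c_nonneg (a) : 0 ≤ c a := div_nonneg (ψ.weights_nonneg _) (φ.weights_nonneg _)
    have c_le_one (a) : c a ≤ 1 := div_le_one_of_le₀ (hψ a) (φ.weights_nonneg _)
    have mul_c (a) : φ.weights (some a) * c a = ψ.weights (some a) :=
      mul_div_cancel_of_imp' fun h => ((hψ a).trans_eq h).antisymm (ψ.weights_nonneg _)
    let g : Option A → Distr (Option A)
      | some a => StdSimplex.duple (some a) none (c_nonneg a) (sub_nonneg.2 (c_le_one a))
          (add_sub_cancel _ 1)
      | none => StdSimplex.single none
    refine mem_minkowskiSum.2 ⟨g, fun o _ => ?_, ext_some fun a => ?_⟩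
    · cases o with
      | none => exact self_mem_below _
      | some a => exact cdownUnit_eq_below a ▸ ⟨c a, c_nonneg a, c_le_one a, rfl⟩
    · rw [weights_iConvexComb_apply, ← mul_c, ← iConvexComb_piSingle]
      refine iConvexComb_congr fun o _ => ?_
      cases o with
      | none => simp [g]
      | some b => by_cases h : b = a <;> simp [g, h]

lemma minkowskiBind_below_single_subset_iff :
    minkowskiBind S (fun o => Below (StdSimplex.single o)) ⊆ S ↔ IsBotClosed S := by
  simp only [minkowskiBind, minkowskiSum_below_single, Set.iUnion₂_subset_iff]
  rfl

lemma IsBotClosed.minkowskiBind_below_single (hS : IsBotClosed S) :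
    minkowskiBind S (fun o => Below (StdSimplex.single o)) = S := by
  refine (minkowskiBind_below_single_subset_iff.2 hS).antisymm fun φ hφ =>
    minkowskiSum_subset_minkowskiBind hφ ?_
  rw [minkowskiSum_below_single]
  exact self_mem_below φ

lemma IsBotClosed.cdownMap (hS : IsBotClosed S) (f : A → B) : IsBotClosed (cdownMap f S) := by
  rw [← minkowskiBind_below_single_subset_iff, _root_.cdownMap,
    minkowskiBind_image_map (G := fun o => Below (StdSimplex.single o))
      fun _ => isConvexSet_below _]
  simp only [← cdownMap_below_single]
  exact (image_minkowskiBind (StdSimplex.isAffineMap_map ℝ _) S _).symm.trans_subset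
    (Set.image_mono hS.minkowskiBind_below_single.subset)

lemma isBotClosed_minkowskiBind {I : Type*} (S : Set (StdSimplex ℝ I))
    {G : I → Set (Distr (Option A))} (hG : ∀ i, IsBotClosed (G i)) :
    IsBotClosed (minkowskiBind S G) := by
  rw [← minkowskiBind_below_single_subset_iff, minkowskiBind_assoc fun _ => isConvexSet_below _]
  simp only [(hG _).minkowskiBind_below_single, subset_refl]

end BotClosed

section Multiplication

variable {A : Type u}

lemma wms_eq_minkowskiSum (Ψ : Distr (Set (Distr A))) : wms Ψ = minkowskiSum Ψ id := by
  ext θ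
  simp [wms, mem_minkowskiSum, eq_comm]

lemma isFGConvex_cdownStar (o : Option (Cdown A)) : IsFGConvex (cdownStar o) := by
  cases o with
  | none => exact isFGConvex_singleton _
  | some U => exact U.2.1

lemma isBotClosed_cdownStar (o : Option (Cdown A)) : IsBotClosed (cdownStar o) := by
  cases o with
  | none =>
    simpa only [cdownStar, below_single_none] using isBotClosed_below (StdSimplex.single none)
  | some U => exact U.2.2

lemma isConvexSet_cdownStar (o : Option (Cdown A)) : IsConvexSet ℝ (cdownStar o) :=
  (isFGConvex_cdownStar o).convex

lemma cdownMul_eq_minkowskiBind (S : Set (Distr (Option (Cdown A)))) :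
    cdownMul S = minkowskiBind S cdownStar := by
  simp only [cdownMul, wms_eq_minkowskiSum]
  exact Set.iUnion₂_congr fun Φ _ => minkowskiSum_map (G := id) isConvexSet_cdownStar Φ

end Multiplication

namespace Cdown

variable {A B C : Type u}

/-- The action of the set functor `C↓` on maps. -/
def map (f : A → B) (U : Cdown A) : Cdown B :=
  ⟨cdownMap f U.toSet, U.2.1.image_map _, U.2.2.cdownMap f⟩

/-- The unit of the set monad `C↓`. -/
def pure (x : A) : Cdown A :=
  ⟨cdownUnit x, cdownUnit_eq_below x ▸ isFGConvex_below_single _,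
    cdownUnit_eq_below x ▸ isBotClosed_below _⟩

/-- The multiplication of the set monad `C↓`. -/
def join (S : Cdown (Cdown A)) : Cdown A :=
  ⟨cdownMul S.toSet,
    cdownMul_eq_minkowskiBind S.toSet ▸ S.2.1.minkowskiBind isFGConvex_cdownStar,
    cdownMul_eq_minkowskiBind S.toSet ▸ isBotClosed_minkowskiBind _ isBotClosed_cdownStar⟩

lemma toSet_injective : Function.Injective (toSet (A := A)) := Subtype.val_injective

lemma toSet_map (f : A → B) (U : Cdown A) :
    (map f U).toSet = StdSimplex.map (Option.map f) '' U.toSet := rfl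

lemma toSet_pure (x : A) : (pure x).toSet = Below (StdSimplex.single (some x)) :=
  cdownUnit_eq_below x

lemma toSet_join (S : Cdown (Cdown A)) : S.join.toSet = minkowskiBind S.toSet cdownStar :=
  cdownMul_eq_minkowskiBind S.toSet

lemma cdownStar_map (f : A → B) (o : Option (Cdown A)) :
    cdownStar (o.map (map f)) = StdSimplex.map (Option.map f) '' cdownStar o := by
  cases o with
  | none => simp [cdownStar]
  | some U => rfl

lemma cdownStar_pure (o : Option A) : cdownStar (o.map pure) = Below (StdSimplex.single o) := by
  cases o with
  | none => exact below_single_none.symm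
  | some x => exact cdownUnit_eq_below x

lemma cdownStar_join (o : Option (Cdown (Cdown A))) :
    cdownStar (o.map join) = minkowskiBind (cdownStar o) cdownStar := by
  cases o with
  | none => simp [cdownStar, minkowskiBind]
  | some S => exact cdownMul_eq_minkowskiBind S.toSet

lemma map_id (U : Cdown A) : map id U = U :=
  toSet_injective <| by simp [toSet_map]

lemma map_map (g : B → C) (f : A → B) (U : Cdown A) : map g (map f U) = map (g ∘ f) U :=
  toSet_injective <| by
    simp only [toSet_map, Set.image_image, StdSimplex.map_map, Option.map_map, Function.comp_def]

lemma map_pure (f : A → B) (x : A) : map f (pure x) = pure (f x) :=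
  toSet_injective <| by
    rw [toSet_map, toSet_pure, toSet_pure]
    exact cdownMap_below_single f (some x)

lemma map_join (f : A → B) (S : Cdown (Cdown A)) : map f S.join = (map (map f) S).join :=
  toSet_injective <| by
    simp only [toSet_map, toSet_join, minkowskiBind_image_map (fun _ => isConvexSet_cdownStar _),
      cdownStar_map]
    exact image_minkowskiBind (StdSimplex.isAffineMap_map ℝ _) _ _

lemma join_map_join (S : Cdown (Cdown (Cdown A))) : (map join S).join = S.join.join :=
  toSet_injective <| by
    simp only [toSet_map, toSet_join, minkowskiBind_image_map (fun _ => isConvexSet_cdownStar _),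
      cdownStar_join, minkowskiBind_assoc isConvexSet_cdownStar]

lemma join_pure (U : Cdown A) : (pure U).join = U :=
  toSet_injective <| by
    have single_none_mem : StdSimplex.single none ∈ U.toSet :=
      U.2.1.nonempty.elim fun φ hφ => U.2.2 φ hφ _ (single_none_mem_below φ)
    have star_eq : (cdownStar : Option (Cdown A) → _) = fun o =>
        Convexity.convexHull ℝ (cdownStar o) :=
      funext fun o => (IsConvexSet.convexHull_eq_self (isConvexSet_cdownStar o)).symm
    calc (pure U).join.toSet
      _ = Convexity.convexHull ℝ (minkowskiBind {StdSimplex.single (some U), StdSimplex.single none}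
          cdownStar) := by
        rw [convexHull_minkowskiBind _ fun o => (isFGConvex_cdownStar o).nonempty, ← star_eq,
          ← below_single, ← toSet_pure, toSet_join]
      _ = Convexity.convexHull ℝ (insert (StdSimplex.single none) U.toSet) := by
        rw [minkowskiBind, Set.biUnion_pair, minkowskiSum_single, minkowskiSum_single,
          Set.union_comm]
        rfl
      _ = U.toSet := by
        rw [Set.insert_eq_of_mem single_none_mem]
        exact IsConvexSet.convexHull_eq_self U.2.1.convex

lemma join_map_pure (U : Cdown A) : (map pure U).join = U :=
  toSet_injective <| by
    rw [toSet_join, toSet_map, minkowskiBind_image_map fun _ => isConvexSet_cdownStar _]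
    simp only [cdownStar_pure]
    exact U.2.2.minkowskiBind_below_single

end Cdown

section Nonexpansive

variable {X Y : OneMet.{u}}

lemma hausKant_map_le (f : X ⟶ Y) (S T : Cdown X.carrier) :
    hausKant Y (S.map f.toFun) (T.map f.toFun) ≤ hausKant X S T := by
  have hX := X.isOneBoundedMetric.optionDist.kantorovich
  have hY := Y.isOneBoundedMetric.optionDist
  have optionMap_le (a b : Option X.carrier) :
      optionDist dist (a.map f.toFun) (b.map f.toFun) ≤ optionDist dist a b := by
    cases a <;> cases b <;> simp [optionDist, f.nonexpansive]
  refine hausdorff_le_of_forall_exists_le hY.kantorovich.nonneg hY.kantorovich.symm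
    (D := fun S => (Cdown.map f.toFun S).toSet) (fun S => (Cdown.map f.toFun S).2.1.nonempty)
    (isOneBoundedMetric_hausKant X).symm ?_ S T
  rintro S T _ ⟨φ, hφ, rfl⟩ ε hε
  obtain ⟨ψ, hψ, hlt⟩ :=
    exists_lt_hausdorff_add hX.nonneg hX.le_one T.2.1.nonempty hφ hε
  exact ⟨_, ⟨ψ, hψ, rfl⟩, (kantorovich_map_le hY.nonneg optionMap_le φ ψ).trans hlt.le⟩

lemma hausKant_pure_le (x y : X.carrier) :
    hausKant X (Cdown.pure x) (Cdown.pure y) ≤ dist x y := by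
  have hX := X.isOneBoundedMetric.optionDist
  refine hausdorff_le_of_forall_exists_le hX.kantorovich.nonneg hX.kantorovich.symm
    (D := cdownUnit) (fun x => (Cdown.pure x).2.1.nonempty) dist_comm ?_ x y
  rintro x y _ ⟨p, h₀, h₁, rfl⟩ ε hε
  refine ⟨_, ⟨p, h₀, h₁, rfl⟩, ?_⟩
  let w : StdSimplex ℝ (Option Unit) :=
    StdSimplex.duple (some ()) none h₀ (sub_nonneg.2 h₁) (add_sub_cancel p 1)
  have map_le := kantorovich_map_map_le hX.nonneg w (Option.map fun _ => x) (Option.map fun _ => y)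
  have cost_le (o : Option Unit) :
      optionDist dist (o.map fun _ => x) (o.map fun _ => y) ≤ dist x y := by
    cases o <;> simp [optionDist]
  calc _ ≤ w.iConvexComb fun o => optionDist dist (o.map fun _ => x) (o.map fun _ => y) := by
        simpa [w] using map_le
    _ ≤ w.iConvexComb fun _ => dist x y := iConvexComb_mono fun o _ => cost_le o
    _ ≤ dist x y + ε := by rw [iConvexComb_const]; linarith

lemma exists_mem_cdownStar_kantorovich_le {o : Option (Cdown X.carrier)}
    {φ : Distr (Option X.carrier)} (hφ : φ ∈ cdownStar o) {ε : ℝ} (hε : 0 < ε)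
    (o' : Option (Cdown X.carrier)) :
    ∃ ψ ∈ cdownStar o', kantorovich (optionDist dist) φ ψ ≤ optionDist (hausKant X) o o' + ε := by
  have hX := X.isOneBoundedMetric.optionDist.kantorovich
  have le_one_add (ψ) : kantorovich (optionDist dist) φ ψ ≤ 1 + ε :=
    (hX.le_one φ ψ).trans (by linarith)
  match o, o' with
  | none, none =>
    refine ⟨φ, hφ, ((hX.eq_zero_iff φ φ).2 rfl).trans_le ?_⟩
    simpa only [optionDist, zero_add] using hε.le
  | none, some V => exact V.2.1.nonempty.imp fun ψ hψ => ⟨hψ, le_one_add ψ⟩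
  | some _, none => exact ⟨_, rfl, le_one_add _⟩
  | some _, some V =>
    obtain ⟨ψ, hψ, hlt⟩ := exists_lt_hausdorff_add hX.nonneg hX.le_one V.2.1.nonempty hφ hε
    exact ⟨ψ, hψ, hlt.le⟩

lemma hausKant_join_le (S T : Cdown (Cdown X.carrier)) :
    hausKant X S.join T.join ≤ hausKant (hkObj isOneBoundedMetric_hausKant X) S T := by
  have hX := X.isOneBoundedMetric.optionDist
  have hF := (isOneBoundedMetric_hausKant X).optionDist.kantorovich
  refine hausdorff_le_of_forall_exists_le hX.kantorovich.nonneg hX.kantorovich.symm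
    (D := fun S => (Cdown.join S).toSet) (fun S => (Cdown.join S).2.1.nonempty)
    (isOneBoundedMetric_hausKant (hkObj isOneBoundedMetric_hausKant X)).symm ?_ S T
  intro S T θ hθ ε hε
  simp only [Cdown.toSet_join, mem_minkowskiBind] at hθ ⊢
  obtain ⟨Φ, hΦ, hθ⟩ := hθ
  obtain ⟨g, hg, rfl⟩ :=
    exists_selection_of_mem_minkowskiSum (fun o => (isFGConvex_cdownStar o).nonempty) hθ
  obtain ⟨Ψ, hΨ, hlt⟩ :=
    exists_lt_hausdorff_add hF.nonneg hF.le_one T.2.1.nonempty hΦ (half_pos hε)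
  obtain ⟨ω, ⟨rfl, rfl⟩, hω⟩ := exists_coup_lt hlt
  choose k hk hgk using fun p : Option (Cdown X.carrier) × Option (Cdown X.carrier) =>
    exists_mem_cdownStar_kantorovich_le (hg p.1) (half_pos hε) p.2
  refine ⟨ω.iConvexComb k, ⟨_, hΨ, ?_⟩, ?_⟩
  · rw [minkowskiSum_map fun _ => isConvexSet_cdownStar _]
    exact iConvexComb_mem_minkowskiSum fun p _ => hk p
  · rw [iConvexComb_map]
    calc _ ≤ ω.iConvexComb fun p => kantorovich (optionDist dist) (g p.1) (k p) :=
          kantorovich_iConvexComb_le hX.nonneg ω _ k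
      _ ≤ ω.iConvexComb fun p => optionDist (hausKant X) p.1 p.2 + ε / 2 :=
          iConvexComb_mono fun p _ => hgk p
      _ = (ω.iConvexComb fun p => optionDist (hausKant X) p.1 p.2) + ε / 2 := by
          rw [iConvexComb_add, iConvexComb_const]
      _ ≤ hausdorff (kantorovich (optionDist (hausKant X))) S.toSet T.toSet + ε / 2 + ε / 2 :=
          add_le_add_left hω.le _
      _ = hausdorff (kantorovich (optionDist (hausKant X))) S.toSet T.toSet + ε := by ring

end Nonexpansive

theorem mainTheorem6 :
    -- the Hausdorff–Kantorovich distance is a 1-bounded metric on every `C↓(X)`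
    ∃ (hHK : ∀ X : OneMet.{u}, IsOneBoundedMetric (hausKant X))
      -- the functor `X ↦ (C↓(X), HK(d))`
      (map : ∀ {X Y : OneMet.{u}}, (X ⟶ Y) → (hkObj hHK X ⟶ hkObj hHK Y))
      (map_id : ∀ X : OneMet.{u}, map (𝟙 X) = 𝟙 (hkObj hHK X))
      (map_comp : ∀ {X Y Z : OneMet.{u}} (f : X ⟶ Y) (g : Y ⟶ Z),
        map (f ≫ g) = map f ≫ map g),
      let F : OneMet.{u} ⥤ OneMet.{u} :=
        { obj := hkObj hHK, map := map, map_id := map_id, map_comp := map_comp }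
      -- a monad with this functor
      ∃ (η : 𝟭 OneMet.{u} ⟶ F) (μ : F ⋙ F ⟶ F)
        (assoc : ∀ X, F.map (μ.app X) ≫ μ.app X = μ.app (F.obj X) ≫ μ.app X)
        (left_unit : ∀ X, η.app (F.obj X) ≫ μ.app X = 𝟙 (F.obj X))
        (right_unit : ∀ X, F.map (η.app X) ≫ μ.app X = 𝟙 (F.obj X)),
        let M : CategoryTheory.Monad OneMet.{u} :=
          { toFunctor := F, η := η, μ := μ, assoc := assoc,
            left_unit := left_unit, right_unit := right_unit }
        -- whose underlying maps are those of the set monad `C↓`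
        (∀ (X Y : OneMet.{u}) (f : X ⟶ Y) (S : Cdown X.carrier),
          Cdown.toSet (A := Y.carrier) ((M.map f).toFun S) =
            cdownMap f.toFun S.toSet) ∧
        (∀ (X : OneMet.{u}) (x : X.carrier),
          Cdown.toSet (A := X.carrier) ((M.η.app X).toFun x) =
            cdownUnit x) ∧
        (∀ (X : OneMet.{u}) (S : Cdown (Cdown X.carrier)),
          Cdown.toSet (A := X.carrier) ((M.μ.app X).toFun S) =
            cdownMul S.toSet) := by
  exact ⟨isOneBoundedMetric_hausKant,
    fun f => ⟨Cdown.map f.toFun, hausKant_map_le f⟩,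
    fun X => OneMet.Hom.ext (funext Cdown.map_id),
    fun f g => OneMet.Hom.ext (funext fun U => (Cdown.map_map g.toFun f.toFun U).symm),
    { app := fun X => ⟨Cdown.pure, hausKant_pure_le⟩
      naturality := fun X Y f => OneMet.Hom.ext
        (funext fun x => (Cdown.map_pure f.toFun x).symm) },
    { app := fun X => ⟨Cdown.join, hausKant_join_le⟩
      naturality := fun X Y f => OneMet.Hom.ext
        (funext fun S => (Cdown.map_join f.toFun S).symm) },
    fun X => OneMet.Hom.ext (funext Cdown.join_map_join),
    fun X => OneMet.Hom.ext (funext Cdown.join_pure),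
    fun X => OneMet.Hom.ext (funext Cdown.join_map_pure),
    fun _ _ _ _ => rfl, fun _ _ => rfl, fun _ _ => rfl⟩
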